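/- Let $\mathbf G=\sum_{k\ge 0}(-1)^k/(2k+1)^2$ be the Catalan constant. Let $t\ge 0$ be an integer and let $F\in\mathbb Q[x,y]$ be such that (i) $F$ is fixed by the $\mathbb Q$-algebra automorphism $\sigma$ of $\mathbb Q[x,y]$ with $\sigma(x)=-y$, $\sigma(y)=x$, and (ii) $x^{2\lceil t/2\rceil}y^{2\lceil t/2\rceil}$ divides $F$ in $\mathbb Q[x,y]$. Then the integral of $$\frac{F\,dx\,dy}{(1-x^2-y^2)^{t+1}}$$ over the simplex $\Delta=\{(x,y)\in\mathbb R^2: x\ge 0,\ y\ge 0,\ x+y\le 1\}$ converges absolutely, and its value is a $\mathbb Q$-linear combination of $1$ and $\mathbf G$. Explicitly, if $F=\sum_{m,n}c_{m,n}x^my^n$, then $$\int_\Delta \frac{F\,dx\,dy}{(1-x^2-y^2)^{t+1}}=\sum_{u,v}c_{2u,2v}\,a_t(u,v)+\Big(\sum_{u,v}c_{2u,2v}\,b_t(u,v)\Big)\mathbf G ,$$ where both sums run over the pairs of non-negative integers $u,v$ with $c_{2u,2v}\ne 0$ (so $u,v\ge\lceil t/2\rceil$), and $a_t(u,v),b_t(u,v)$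 are the following rational numbers. First, $$b_t(u,v)=\frac{(-1)^t\binom{2u}{u}\binom{2v}{v}\binom{u+v}{t}}{4^{u+v}\binom{u+v}{u}}.$$ Next, let $A_0(0,0)=0$ and, for $i,j\ge 0$, $$A_0(0,j+1)=\tfrac{2j+1}{2j+2}A_0(0,j)-\tfrac{(2j)!}{2\,(2j+2)!},\qquad A_0(i+1,j)=\tfrac{2i+1}{2i+2j+2}A_0(i,j)-\tfrac{(2i)!\,(2j)!}{2\,(2i+2j+2)!};$$ for $s,i,j\ge 0$ let $$A_{s+1}(i,j)=\frac{(2s+2i+1)(2s+2j+1)\,A_s(i,j)-2^{-(2s+1)}\binom{2i+2j}{2i}^{-1}}{4(2s+1)(2s+2)} .$$ Then, for all $s\geq 0$, one has $a_{2s}(u,v)=A_s(u-s,v-s)$ for $u,v\ge s$, and for $i,j\ge 0$ $$a_{2s+1}(s+1+i,s+1+j)=\frac{1}{4(2s+1)}\left(\frac{(2i)!\,(2j)!}{2^{2s+1}(2i+2j+1)!}-(2s+2i+1)A_s(i,j+1)-(2s+2j+1)A_s(i+1,j)\right).$$ -/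

import Mathlib

namespace CatalanForms

open MeasureTheory MvPolynomial

/-- The Catalan constant `G = 1 - 1/3^2 + 1/5^2 - 1/7^2 + ...` (the series converges absolutely). -/
noncomputable def catalanConst : ℝ := ∑' k : ℕ, (-1 : ℝ) ^ k / (2 * (k : ℝ) + 1) ^ 2

/-- The `ℚ`-algebra endomorphism `σ` of `ℚ[x,y]` with `σ x = -y` and `σ y = x`,
where `x = X 0` and `y = X 1`. -/
noncomputable def sigma : MvPolynomial (Fin 2) ℚ →ₐ[ℚ] MvPolynomial (Fin 2) ℚ :=
  aeval ![-X 1, X 0]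

/-- The closed simplex `{(x,y) : x ≥ 0, y ≥ 0, 1 - x - y ≥ 0}` in the real plane. -/
def simplex : Set (ℝ × ℝ) := {p | 0 ≤ p.1 ∧ 0 ≤ p.2 ∧ 0 ≤ 1 - p.1 - p.2}

/-- The function `F(x,y) / (1 - x^2 - y^2)^(t+1)` on the real plane. On the simplex the denominator
vanishes only at the two vertices `(1,0)` and `(0,1)`, which form a null set. -/
noncomputable def integrand (t : ℕ) (F : MvPolynomial (Fin 2) ℚ) (p : ℝ × ℝ) : ℝ :=
  aeval ![p.1, p.2] F / (1 - p.1 ^ 2 - p.2 ^ 2) ^ (t + 1)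

/-- The coefficient of `1` for the monomial `x^(2i) y^(2j)` and a pole of order one. -/
def simplePoleOne : ℕ → ℕ → ℚ
  | 0, 0 => 0
  | 0, j + 1 =>
      (2 * j + 1) / (2 * j + 2) * simplePoleOne 0 j
        - (2 * j).factorial / (2 * (2 * j + 2).factorial)
  | i + 1, j =>
      (2 * i + 1) / (2 * i + 2 * j + 2) * simplePoleOne i j
        - (2 * i).factorial * (2 * j).factorial / (2 * (2 * i + 2 * j + 2).factorial)

/-- The coefficient of `1` for the monomial `x^(2s+2i) y^(2s+2j)` and `t = 2s`. -/
def evenPoleOne : ℕ → ℕ → ℕ → ℚ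
  | 0, i, j => simplePoleOne i j
  | s + 1, i, j =>
      ((2 * s + 2 * i + 1) * (2 * s + 2 * j + 1) * evenPoleOne s i j
        - 1 / (2 ^ (2 * s + 1) * (2 * i + 2 * j).choose (2 * i)))
          / (4 * (2 * s + 1) * (2 * s + 2))

/-- The coefficient of `1` for the monomial `x^(2s+2+2i) y^(2s+2+2j)` and `t = 2s+1`. -/
def oddPoleOne (s i j : ℕ) : ℚ :=
  ((2 * i).factorial * (2 * j).factorial / (2 ^ (2 * s + 1) * (2 * i + 2 * j + 1).factorial)
    - (2 * s + 2 * i + 1) * evenPoleOne s i (j + 1)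
    - (2 * s + 2 * j + 1) * evenPoleOne s (i + 1) j) / (4 * (2 * s + 1))

/-- The coefficient of `1` for the monomial `x^(2u) y^(2v)` and arbitrary `t`. It is used only when
`u` and `v` are at least `⌈t/2⌉`, so that the subtractions are not truncated. -/
def monomialOne (t u v : ℕ) : ℚ :=
  if Even t then evenPoleOne (t / 2) (u - t / 2) (v - t / 2)
  else oddPoleOne (t / 2) (u - (t / 2 + 1)) (v - (t / 2 + 1))

/-- The coefficient of the Catalan constant for the monomial `x^(2u) y^(2v)` and arbitrary `t`. -/
def monomialCatalan (t u v : ℕ) : ℚ :=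
  (-1) ^ t * ((2 * u).choose u * (2 * v).choose v * (u + v).choose t)
    / (4 ^ (u + v) * (u + v).choose u)

/-- The coefficient of `1` in the linear form: a sum over the monomials of `F` with both exponents
even. -/
noncomputable def coeffOne (t : ℕ) (F : MvPolynomial (Fin 2) ℚ) : ℚ :=
  ∑ d ∈ F.support with Even (d 0) ∧ Even (d 1), F.coeff d * monomialOne t (d 0 / 2) (d 1 / 2)

/-- The coefficient of the Catalan constant in the linear form: a sum over the monomials of `F` with
both exponents even. -/
noncomputable def coeffCatalan (t : ℕ) (F : MvPolynomial (Fin 2) ℚ) : ℚ :=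
  ∑ d ∈ F.support with Even (d 0) ∧ Even (d 1), F.coeff d * monomialCatalan t (d 0 / 2) (d 1 / 2)

end CatalanForms

namespace CatalanForms

open MeasureTheory MvPolynomial

/-! Write `D = 1 - x^2 - y^2` and `I_k(m,n)` for the integral of `x^m y^n / D^k` over the simplex.
Since `x + y ≤ 1` gives `D ≥ 2xy`, this integral converges when `m, n ≥ k - 1`.

The only transcendental input is `I_1(0,0) = G`: integrating in `y` gives a logarithm, and `x =
2s/(1+s^2)` turns the rest into the integral of `-log s/(1+s^2)` over `(0,1)`, which is summed as a
geometric series.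

Everything else is Stokes. On the edge `y = 1 - x` one has `D = 2x(1-x)`, so suitable exact forms
have rational Beta integrals as boundary terms (`monomialIntegral_stokes_snd`,
`monomialIntegral_stokes_fst`). Together with `monomialIntegral_lower_pole` they give recurrences in
the exponents and the pole order which reduce each even monomial to `I_1(0,0)`. The inhomogeneous
recurrences define the coefficient of `1`; their homogeneous parts are solved by the closed form
`monomialCatalan`.

Invariance under `σ` kills the coefficients of mixed parity and makes the odd-odd ones
antisymmetric, so they cancel against the symmetric integrals (`sum_not_even_eq_zero`). -/

/-! ### The Catalan constant as a logarithmic integral. -/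

theorem hasDerivAt_powLogPrimitive (n : ℕ) {x : ℝ} (hx : x ≠ 0) :
    HasDerivAt (fun x : ℝ => x ^ (n + 1) / ((n : ℝ) + 1) ^ 2 - x ^ n * (x * Real.log x) / (n + 1))
      (-(x ^ n * Real.log x)) x := by
  have h1 := (hasDerivAt_pow (n + 1) x).div_const (((n : ℝ) + 1) ^ 2)
  have h2 := ((hasDerivAt_pow (n + 1) x).mul (Real.hasDerivAt_log hx)).div_const ((n : ℝ) + 1)
  have h3 := h1.sub h2
  refine (h3.congr_deriv ?_).congr_of_eventuallyEq ?_
  · push_cast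
    have : (n : ℝ) + 1 ≠ 0 := by positivity
    field_simp
    ring
  · refine Filter.Eventually.of_forall fun y => ?_
    simp only [Pi.sub_apply, Pi.mul_apply]
    ring

/-- A factor `x` is kept next to `log x` because `x * log x` is continuous at `0`; the fundamental
theorem then needs the derivative only inside the interval. -/
theorem continuous_powLogPrimitive (n : ℕ) :
    Continuous (fun x : ℝ =>
      x ^ (n + 1) / ((n : ℝ) + 1) ^ 2 - x ^ n * (x * Real.log x) / (n + 1)) := by
  have := Real.continuous_mul_log
  fun_prop

theorem integrableOn_pow_mul_log (n : ℕ) :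
    IntegrableOn (fun x : ℝ => -(x ^ n * Real.log x)) (Set.Ioc 0 1) := by
  refine intervalIntegral.integrableOn_deriv_of_nonneg
    (continuous_powLogPrimitive n).continuousOn
    (fun x hx => hasDerivAt_powLogPrimitive n hx.1.ne') fun x hx => ?_
  have := Real.log_nonpos hx.1.le hx.2.le
  have := pow_nonneg hx.1.le n
  nlinarith

theorem integral_pow_mul_log (n : ℕ) :
    ∫ x in Set.Ioc (0 : ℝ) 1, -(x ^ n * Real.log x) = 1 / ((n : ℝ) + 1) ^ 2 := by
  rw [← intervalIntegral.integral_of_le zero_le_one,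
    intervalIntegral.integral_eq_sub_of_hasDerivAt_of_le zero_le_one
      (continuous_powLogPrimitive n).continuousOn
      (fun x hx => hasDerivAt_powLogPrimitive n hx.1.ne')
      ((intervalIntegrable_iff_integrableOn_Ioc_of_le zero_le_one).2 (integrableOn_pow_mul_log n))]
  simp

theorem integrableOn_neg_log_div :
    IntegrableOn (fun x : ℝ => -Real.log x / (1 + x ^ 2)) (Set.Ioc 0 1) := by
  refine Integrable.mono' (integrableOn_pow_mul_log 0)
    (Measurable.aestronglyMeasurable (by fun_prop)) ?_
  filter_upwards [ae_restrict_mem measurableSet_Ioc] with x hx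
  have := Real.log_nonpos hx.1.le hx.2
  rw [Real.norm_of_nonneg (div_nonneg (by linarith) (by positivity)), pow_zero, one_mul]
  exact div_le_self (by linarith) (by nlinarith [sq_nonneg x])

theorem summable_one_div_odd_sq : Summable fun k : ℕ => 1 / (2 * (k : ℝ) + 1) ^ 2 := by
  have h : Summable fun k : ℕ => 1 / ((k : ℝ) + 1) ^ 2 := by
    simpa using (summable_nat_add_iff 1).2 (Real.summable_one_div_nat_pow.2 one_lt_two)
  refine Summable.of_nonneg_of_le (fun k => by positivity) (fun k => ?_) h
  gcongr
  linarith [k.cast_nonneg (α := ℝ)]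

theorem integral_neg_log_div :
    ∫ x in Set.Ioc (0 : ℝ) 1, -Real.log x / (1 + x ^ 2) = catalanConst := by
  have hn (k : ℕ) : ∫ x in Set.Ioc (0 : ℝ) 1, ‖(-1 : ℝ) ^ k * -(x ^ (2 * k) * Real.log x)‖
      = 1 / (2 * (k : ℝ) + 1) ^ 2 := by
    have := integral_pow_mul_log (2 * k)
    push_cast at this
    rw [← this]
    refine setIntegral_congr_fun measurableSet_Ioc fun x hx => ?_
    have h1 := Real.log_nonpos hx.1.le hx.2
    have h2 := pow_nonneg hx.1.le (2 * k)
    simp only [norm_mul, norm_pow, norm_neg, norm_one, one_pow, one_mul, Real.norm_eq_abs,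
      abs_of_nonneg hx.1.le, abs_of_nonpos h1]
    ring
  have key := hasSum_integral_of_summable_integral_norm
    (μ := volume.restrict (Set.Ioc (0 : ℝ) 1))
    (F := fun (k : ℕ) (x : ℝ) => (-1 : ℝ) ^ k * -(x ^ (2 * k) * Real.log x))
    (fun k => (integrableOn_pow_mul_log (2 * k)).const_mul _)
    (by simpa only [hn] using summable_one_div_odd_sq)
  rw [catalanConst]
  have h1 : ∫ x in Set.Ioc (0 : ℝ) 1, -Real.log x / (1 + x ^ 2) =
      ∫ x in Set.Ioc (0 : ℝ) 1, ∑' k : ℕ, (-1 : ℝ) ^ k * -(x ^ (2 * k) * Real.log x) := by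
    -- The endpoint `1` is dropped because the geometric series in `-x^2` does not converge there.
    rw [integral_Ioc_eq_integral_Ioo, integral_Ioc_eq_integral_Ioo]
    refine setIntegral_congr_fun measurableSet_Ioo fun x hx => ?_
    have hx2 : |-(x ^ 2)| < 1 := by
      rw [abs_neg, abs_of_nonneg (sq_nonneg x)]
      exact pow_lt_one₀ hx.1.le hx.2 two_ne_zero
    have h := (hasSum_geometric_of_abs_lt_one hx2).mul_right (-Real.log x)
    have h' : (fun k : ℕ => (-(x ^ 2)) ^ k * -Real.log x) =
        fun k : ℕ => (-1 : ℝ) ^ k * -(x ^ (2 * k) * Real.log x) := by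
      funext k
      rw [neg_pow, ← pow_mul]
      ring
    rw [h'] at h
    simp only [h.tsum_eq]
    rw [sub_neg_eq_add, div_eq_inv_mul]
  rw [h1, ← key.tsum_eq]
  refine tsum_congr fun k => ?_
  rw [integral_const_mul, integral_pow_mul_log]
  push_cast
  ring

/-! ### Fubini on the simplex. -/

theorem isClosed_simplex : IsClosed simplex := by
  have h1 : IsClosed {p : ℝ × ℝ | 0 ≤ p.1} := isClosed_le (by fun_prop) (by fun_prop)
  have h2 : IsClosed {p : ℝ × ℝ | 0 ≤ p.2} := isClosed_le (by fun_prop) (by fun_prop)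
  have h3 : IsClosed {p : ℝ × ℝ | 0 ≤ 1 - p.1 - p.2} := isClosed_le (by fun_prop) (by fun_prop)
  exact h1.inter (h2.inter h3)

theorem measurableSet_simplex : MeasurableSet simplex := isClosed_simplex.measurableSet

theorem indicator_simplex_slice (f : ℝ × ℝ → ℝ) (x : ℝ) :
    (fun y => simplex.indicator f (x, y)) =
      (Set.Icc (0 : ℝ) 1).indicator (fun x => (Set.Icc (0 : ℝ) (1 - x)).indicator
        (fun y => f (x, y))) x := by
  funext y
  by_cases hx : x ∈ Set.Icc (0 : ℝ) 1
  · rw [Set.indicator_of_mem hx]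
    by_cases hy : y ∈ Set.Icc 0 (1 - x)
    · rw [Set.indicator_of_mem hy, Set.indicator_of_mem]
      exact ⟨hx.1, hy.1, by linarith [hy.2]⟩
    · rw [Set.indicator_of_notMem hy, Set.indicator_of_notMem]
      rintro ⟨h1, h2, h3⟩
      exact hy ⟨h2, by simpa using h3⟩
  · rw [Set.indicator_of_notMem hx, Set.indicator_of_notMem, Pi.zero_apply]
    rintro ⟨h1, h2, h3⟩
    simp only at h1 h2 h3
    exact hx ⟨h1, by linarith⟩

theorem integral_indicator_simplex_slice (f : ℝ × ℝ → ℝ) (x : ℝ) :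
    ∫ y, simplex.indicator f (x, y) =
      (Set.Icc (0 : ℝ) 1).indicator (fun x => ∫ y in Set.Ioc 0 (1 - x), f (x, y)) x := by
  rw [indicator_simplex_slice]
  by_cases hx : x ∈ Set.Icc (0 : ℝ) 1
  · rw [Set.indicator_of_mem hx, Set.indicator_of_mem hx, integral_indicator measurableSet_Icc,
      integral_Icc_eq_integral_Ioc]
  · rw [Set.indicator_of_notMem hx, Set.indicator_of_notMem hx]
    simp

theorem setIntegral_simplex {f : ℝ × ℝ → ℝ} (hf : IntegrableOn f simplex) :
    ∫ p in simplex, f p = ∫ x in Set.Ioo 0 1, ∫ y in Set.Ioc 0 (1 - x), f (x, y) := by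
  rw [← integral_indicator measurableSet_simplex, Measure.volume_eq_prod,
    integral_prod _ ((integrable_indicator_iff measurableSet_simplex).2 hf)]
  simp_rw [integral_indicator_simplex_slice]
  rw [integral_indicator measurableSet_Icc, integral_Icc_eq_integral_Ioo]

/-- The end slices are excluded on purpose: at `x = 0` the function `1/(1 - y^2)` is not integrable
up to `y = 1`. -/
theorem integrableOn_simplex_of_slices {f : ℝ × ℝ → ℝ} (hf : Measurable f)
    (h1 : ∀ x ∈ Set.Ioo (0 : ℝ) 1, IntegrableOn (fun y => f (x, y)) (Set.Ioc 0 (1 - x)))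
    (h2 : IntegrableOn (fun x => ∫ y in Set.Ioc 0 (1 - x), ‖f (x, y)‖) (Set.Ioo 0 1)) :
    IntegrableOn f simplex := by
  rw [← integrable_indicator_iff measurableSet_simplex, Measure.volume_eq_prod,
    integrable_prod_iff (hf.indicator measurableSet_simplex).aestronglyMeasurable]
  constructor
  · have h0 : ∀ᵐ x : ℝ, x ≠ 0 := by simp [ae_iff, measure_singleton]
    have h1' : ∀ᵐ x : ℝ, x ≠ 1 := by simp [ae_iff, measure_singleton]
    filter_upwards [h0, h1'] with x hx0 hx1
    rw [indicator_simplex_slice]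
    by_cases hx : x ∈ Set.Icc (0 : ℝ) 1
    · rw [Set.indicator_of_mem hx, integrable_indicator_iff measurableSet_Icc,
        integrableOn_Icc_iff_integrableOn_Ioc]
      exact h1 x ⟨lt_of_le_of_ne hx.1 hx0.symm, lt_of_le_of_ne hx.2 hx1⟩
    · rw [Set.indicator_of_notMem hx]
      exact integrable_zero _ _ _
  · have h : (fun x => ∫ y, ‖simplex.indicator f (x, y)‖) =
        (Set.Icc (0 : ℝ) 1).indicator (fun x => ∫ y in Set.Ioc 0 (1 - x), ‖f (x, y)‖) := by
      funext x
      rw [← integral_indicator_simplex_slice (fun p => ‖f p‖)]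
      simp only [norm_indicator_eq_indicator_norm]
    rw [h, integrable_indicator_iff measurableSet_Icc, integrableOn_Icc_iff_integrableOn_Ioo]
    exact h2

/-! ### The base integral of `1/(1 - x^2 - y^2)`. -/

theorem hasDerivAt_artanhPrimitive {c y : ℝ} (hc : 0 < c) (hy0 : 0 ≤ y) (hyc : y < c) :
    HasDerivAt (fun y => (Real.log (c + y) - Real.log (c - y)) / (2 * c)) (1 / (c ^ 2 - y ^ 2))
      y := by
  have h1 := ((hasDerivAt_id y).const_add c).log (by simp; linarith)
  have h2 := ((hasDerivAt_id y).const_sub c).log (by simp; linarith)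
  refine ((h1.sub h2).div_const (2 * c)).congr_deriv ?_
  have e1 : c + y ≠ 0 := by linarith
  have e2 : c - y ≠ 0 := by linarith
  have e3 : c ^ 2 - y ^ 2 ≠ 0 := by
    rw [sq_sub_sq]
    exact mul_ne_zero e1 e2
  simp only [id]
  field_simp
  ring

theorem den_pos {x y : ℝ} (hx : 0 < x) (hy : 0 ≤ y) (hxy : y ≤ 1 - x) (hx1 : x < 1) :
    0 < 1 - x ^ 2 - y ^ 2 := by
  nlinarith [mul_pos hx (sub_pos.2 hx1)]

theorem integral_slice_one_div_den {x c : ℝ} (hx : x ∈ Set.Ioo (0 : ℝ) 1) (hc : 0 < c)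
    (hcx : c ^ 2 = 1 - x ^ 2) :
    ∫ y in Set.Ioc 0 (1 - x), 1 / (1 - x ^ 2 - y ^ 2) =
      (Real.log (c + (1 - x)) - Real.log (c - (1 - x))) / (2 * c) := by
  have h0 : 0 ≤ 1 - x := by linarith [hx.2]
  have hlt : 1 - x < c := by
    apply lt_of_pow_lt_pow_left₀ 2 hc.le
    rw [hcx]
    nlinarith [hx.1, hx.2]
  have hd : ∀ y ∈ Set.uIcc 0 (1 - x),
      HasDerivAt (fun y => (Real.log (c + y) - Real.log (c - y)) / (2 * c))
        (1 / (1 - x ^ 2 - y ^ 2)) y := by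
    intro y hy
    rw [Set.uIcc_of_le h0] at hy
    rw [← hcx]
    exact hasDerivAt_artanhPrimitive hc hy.1 (by linarith [hy.2])
  rw [← intervalIntegral.integral_of_le h0, intervalIntegral.integral_eq_sub_of_hasDerivAt hd]
  · simp
  · refine ContinuousOn.intervalIntegrable ?_
    refine ContinuousOn.div (by fun_prop) (by fun_prop) fun y hy => ?_
    rw [Set.uIcc_of_le h0] at hy
    exact (den_pos hx.1 hy.1 hy.2 hx.2).ne'

theorem hasDerivAt_doubling (s : ℝ) :
    HasDerivAt (fun s : ℝ => 2 * s / (1 + s ^ 2)) (2 * (1 - s ^ 2) / (1 + s ^ 2) ^ 2) s := by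
  have h : (1 : ℝ) + s ^ 2 ≠ 0 := by positivity
  have := ((hasDerivAt_id s).const_mul 2).div ((hasDerivAt_pow 2 s).const_add 1) h
  refine this.congr_deriv ?_
  simp only [id]
  congr 1
  push_cast
  ring

theorem injOn_doubling : Set.InjOn (fun s : ℝ => 2 * s / (1 + s ^ 2)) (Set.Ioo 0 1) := by
  intro s hs r hr h
  simp only at h
  rw [div_eq_div_iff (by positivity) (by positivity)] at h
  have h1 : (s - r) * (1 - s * r) = 0 := by linarith
  have h2 : 1 - s * r ≠ 0 := by nlinarith [hs.1, hs.2, hr.1, hr.2]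
  have := (mul_eq_zero.1 h1).resolve_right h2
  linarith

theorem image_doubling : (fun s : ℝ => 2 * s / (1 + s ^ 2)) '' Set.Ioo 0 1 = Set.Ioo 0 1 := by
  ext x
  constructor
  · rintro ⟨s, ⟨h0, h1⟩, rfl⟩
    refine ⟨by positivity, ?_⟩
    rw [div_lt_one (by positivity)]
    nlinarith
  · rintro ⟨h0, h1⟩
    have hc : 0 ≤ Real.sqrt (1 - x ^ 2) := Real.sqrt_nonneg _
    have hc2 : Real.sqrt (1 - x ^ 2) ^ 2 = 1 - x ^ 2 := Real.sq_sqrt (by nlinarith)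
    set c := Real.sqrt (1 - x ^ 2)
    have hc1 : 0 < 1 + c := by linarith
    -- Half-angle formula: with `x = sin θ` and `c = cos θ`, the preimage is `tan (θ/2) = x/(1+c)`.
    refine ⟨x / (1 + c), ⟨by positivity, ?_⟩, ?_⟩
    · rw [div_lt_one hc1]
      linarith
    · have h : 1 + (x / (1 + c)) ^ 2 = 2 / (1 + c) := by
        field_simp
        linear_combination hc2
      simp only [h]
      field_simp

/-- The substitution rationalizes `c = √(1 - x^2)` to `(1-s^2)/(1+s^2)`, and the quotient of `c -
(1-x)` by `c + (1-x)` becomes exactly `s`. -/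
theorem doubling_substitution {s : ℝ} (hs : s ∈ Set.Ioo (0 : ℝ) 1) :
    |2 * (1 - s ^ 2) / (1 + s ^ 2) ^ 2| *
        ∫ y in Set.Ioc 0 (1 - 2 * s / (1 + s ^ 2)),
          1 / (1 - (2 * s / (1 + s ^ 2)) ^ 2 - y ^ 2) =
      -Real.log s / (1 + s ^ 2) := by
  have hx : 2 * s / (1 + s ^ 2) ∈ Set.Ioo (0 : ℝ) 1 :=
    image_doubling ▸ Set.mem_image_of_mem (fun s : ℝ => 2 * s / (1 + s ^ 2)) hs
  have h1 : 0 < 1 - s ^ 2 := by nlinarith [hs.1, hs.2]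
  have h1' : 0 < 1 - s := by linarith [hs.2]
  have h2 : 0 < s := hs.1
  have h3 : 0 < 1 + s ^ 2 := by positivity
  rw [integral_slice_one_div_den (c := (1 - s ^ 2) / (1 + s ^ 2)) hx (by positivity)
      (by field_simp; ring)]
  have e1 : (1 - s ^ 2) / (1 + s ^ 2) + (1 - 2 * s / (1 + s ^ 2)) =
      2 * (1 - s) / (1 + s ^ 2) := by
    field_simp
    ring
  have e2 : (1 - s ^ 2) / (1 + s ^ 2) - (1 - 2 * s / (1 + s ^ 2)) =
      2 * (1 - s) / (1 + s ^ 2) * s := by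
    field_simp
    ring
  rw [e1, e2, Real.log_mul (by positivity) h2.ne', abs_of_nonneg (by positivity)]
  field_simp
  ring

theorem integrableOn_slices_one_div_den :
    IntegrableOn (fun x : ℝ => ∫ y in Set.Ioc 0 (1 - x), 1 / (1 - x ^ 2 - y ^ 2))
      (Set.Ioo 0 1) := by
  rw [← image_doubling, integrableOn_image_iff_integrableOn_abs_deriv_smul measurableSet_Ioo
    (fun s _ => (hasDerivAt_doubling s).hasDerivWithinAt) injOn_doubling]
  refine ((integrableOn_neg_log_div.mono_set Set.Ioo_subset_Ioc_self).congr_fun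
    (fun s hs => ?_) measurableSet_Ioo)
  exact (doubling_substitution hs).symm

theorem integral_slices_one_div_den :
    ∫ x in Set.Ioo 0 1, ∫ y in Set.Ioc 0 (1 - x), 1 / (1 - x ^ 2 - y ^ 2) = catalanConst := by
  rw [← image_doubling, integral_image_eq_integral_abs_deriv_smul measurableSet_Ioo
    (fun s _ => (hasDerivAt_doubling s).hasDerivWithinAt) injOn_doubling,
    ← integral_neg_log_div, integral_Ioc_eq_integral_Ioo]
  exact setIntegral_congr_fun measurableSet_Ioo fun s hs => doubling_substitution hs

theorem integrableOn_one_div_den :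
    IntegrableOn (fun p : ℝ × ℝ => 1 / (1 - p.1 ^ 2 - p.2 ^ 2)) simplex := by
  refine integrableOn_simplex_of_slices (by fun_prop) (fun x hx => ?_) ?_
  · refine (ContinuousOn.integrableOn_Icc ?_).mono_set Set.Ioc_subset_Icc_self
    refine ContinuousOn.div (by fun_prop) (by fun_prop) fun y hy => ?_
    exact (den_pos hx.1 hy.1 hy.2 hx.2).ne'
  · refine integrableOn_slices_one_div_den.congr_fun (fun x hx => ?_) measurableSet_Ioo
    refine setIntegral_congr_fun measurableSet_Ioc fun y hy => ?_
    have := den_pos hx.1 hy.1.le hy.2 hx.2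
    simp only
    rw [Real.norm_of_nonneg (by positivity)]

theorem integral_one_div_den :
    ∫ p in simplex, 1 / (1 - p.1 ^ 2 - p.2 ^ 2) = catalanConst := by
  rw [setIntegral_simplex integrableOn_one_div_den, integral_slices_one_div_den]

/-! ### Beta integrals for the boundary terms. -/

theorem integral_pow_mul_one_sub_pow_succ (p q : ℕ) :
    ((p : ℝ) + 1) * ∫ x in Set.Ioo (0 : ℝ) 1, x ^ p * (1 - x) ^ (q + 1) =
      ((q : ℝ) + 1) * ∫ x in Set.Ioo (0 : ℝ) 1, x ^ (p + 1) * (1 - x) ^ q := by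
  have hd : ∀ x ∈ Set.uIcc (0 : ℝ) 1, HasDerivAt (fun x : ℝ => x ^ (p + 1) * (1 - x) ^ (q + 1))
      (((p : ℝ) + 1) * (x ^ p * (1 - x) ^ (q + 1)) - ((q : ℝ) + 1) * (x ^ (p + 1) * (1 - x) ^ q))
      x := by
    intro x _
    refine ((hasDerivAt_pow (p + 1) x).mul
      (((hasDerivAt_id x).const_sub 1).fun_pow (q + 1))).congr_deriv ?_
    simp only [id, Nat.add_sub_cancel]
    push_cast
    ring
  have h := intervalIntegral.integral_eq_sub_of_hasDerivAt hd
    (Continuous.intervalIntegrable (by fun_prop) _ _)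
  rw [intervalIntegral.integral_sub (Continuous.intervalIntegrable (by fun_prop) _ _)
    (Continuous.intervalIntegrable (by fun_prop) _ _), intervalIntegral.integral_const_mul,
    intervalIntegral.integral_const_mul, intervalIntegral.integral_of_le zero_le_one,
    intervalIntegral.integral_of_le zero_le_one, integral_Ioc_eq_integral_Ioo,
    integral_Ioc_eq_integral_Ioo] at h
  simp at h
  linarith

theorem integral_pow_mul_one_sub_pow (p q : ℕ) :
    ∫ x in Set.Ioo (0 : ℝ) 1, x ^ p * (1 - x) ^ q =
      (p.factorial * q.factorial : ℝ) / (p + q + 1).factorial := by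
  induction q generalizing p with
  | zero =>
    rw [← integral_Ioc_eq_integral_Ioo, ← intervalIntegral.integral_of_le zero_le_one]
    simp [Nat.factorial_succ]
    field_simp
  | succ q ih =>
    have h := integral_pow_mul_one_sub_pow_succ p q
    rw [ih] at h
    have hp : (p : ℝ) + 1 ≠ 0 := by positivity
    rw [show p + (q + 1) + 1 = p + 1 + q + 1 by ring]
    apply mul_left_cancel₀ hp
    rw [h, Nat.factorial_succ p, Nat.factorial_succ q]
    push_cast
    ring

/-! ### Monomial integrals: convergence and symmetry. -/

/-- The monomial integrand `x^m y^n / (1 - x^2 - y^2)^k`. -/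
noncomputable def monomialForm (k m n : ℕ) (p : ℝ × ℝ) : ℝ :=
  p.1 ^ m * p.2 ^ n / (1 - p.1 ^ 2 - p.2 ^ 2) ^ k

/-- The integral of `monomialForm k m n` over the simplex. -/
noncomputable def monomialIntegral (k m n : ℕ) : ℝ := ∫ p in simplex, monomialForm k m n p

theorem measurable_monomialForm (k m n : ℕ) : Measurable (monomialForm k m n) := by
  unfold monomialForm
  fun_prop

theorem ae_den_pos : ∀ᵐ p ∂(volume.restrict simplex), 0 < 1 - p.1 ^ 2 - p.2 ^ 2 := by
  have h : ∀ᵐ p : ℝ × ℝ, p ∉ ({(1, 0), (0, 1)} : Set (ℝ × ℝ)) := by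
    rw [ae_iff]
    simp only [not_not, Set.ofPred_mem_eq]
    exact (Set.toFinite _).measure_zero _
  filter_upwards [ae_restrict_mem measurableSet_simplex, ae_restrict_of_ae h] with p hp hne
  obtain ⟨x, y⟩ := p
  obtain ⟨h1, h2, h3⟩ := hp
  simp only [Set.mem_insert_iff, Set.mem_singleton_iff, Prod.mk.injEq, not_or, not_and] at *
  by_contra hlt
  have hxy : x * y = 0 := by nlinarith [mul_nonneg h1 h2]
  rcases mul_eq_zero.1 hxy with rfl | rfl
  · exact hne.2 rfl (by nlinarith)
  · exact hne.1 (by nlinarith) rfl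

/-- Each factor `xy/D` is at most `1` on the simplex, so all but one of the poles are absorbed and
`1/D` dominates. -/
theorem integrableOn_monomialForm {k m n : ℕ} (hm : k ≤ m + 1) (hn : k ≤ n + 1) :
    IntegrableOn (monomialForm k m n) simplex := by
  refine Integrable.mono' integrableOn_one_div_den
    (measurable_monomialForm k m n).aestronglyMeasurable ?_
  filter_upwards [ae_restrict_mem measurableSet_simplex, ae_den_pos] with p hp hd
  obtain ⟨x, y⟩ := p
  obtain ⟨h1, h2, h3⟩ := hp
  simp only at *
  have hx1 : x ≤ 1 := by linarith
  have hy1 : y ≤ 1 := by linarith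
  rw [monomialForm, Real.norm_of_nonneg (by positivity)]
  simp only
  cases k with
  | zero =>
    rw [pow_zero, div_one]
    calc x ^ m * y ^ n ≤ 1 := mul_le_one₀ (pow_le_one₀ h1 hx1) (by positivity) (pow_le_one₀ h2 hy1)
      _ ≤ _ := by
        rw [le_div_iff₀ hd]
        nlinarith
  | succ k =>
    have hxy : x * y ≤ 1 - x ^ 2 - y ^ 2 := by nlinarith [mul_nonneg h1 h2]
    rw [div_le_div_iff₀ (by positivity) hd, one_mul, pow_succ]
    refine mul_le_mul_of_nonneg_right ?_ hd.le
    calc x ^ m * y ^ n ≤ x ^ k * y ^ k := by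
          gcongr ?_ * ?_
          · exact pow_le_pow_of_le_one h1 hx1 (by omega)
          · exact pow_le_pow_of_le_one h2 hy1 (by omega)
      _ = (x * y) ^ k := (mul_pow _ _ _).symm
      _ ≤ _ := pow_le_pow_left₀ (mul_nonneg h1 h2) hxy k

theorem monomialIntegral_swap (k m n : ℕ) : monomialIntegral k m n = monomialIntegral k n m := by
  have h := (Measure.measurePreserving_swap (μ := (volume : Measure ℝ))
    (ν := (volume : Measure ℝ))).setIntegral_preimage_emb
      (MeasurableEquiv.prodComm (α := ℝ) (β := ℝ)).measurableEmbedding (monomialForm k n m) simplex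
  have hpre : Prod.swap ⁻¹' simplex = simplex := by
    ext ⟨x, y⟩
    simp only [simplex, Set.mem_preimage, Set.mem_ofPred_eq, Prod.swap]
    constructor <;> rintro ⟨h1, h2, h3⟩ <;> exact ⟨h2, h1, by linarith⟩
  rw [hpre] at h
  rw [monomialIntegral, monomialIntegral, Measure.volume_eq_prod, ← h]
  refine integral_congr_ae (Filter.Eventually.of_forall fun p => ?_)
  simp only [monomialForm, Prod.fst_swap, Prod.snd_swap]
  rw [mul_comm, sub_right_comm]

/-! ### Stokes relations and recurrences. -/

theorem monomialIntegral_lower_pole {k m n : ℕ} (hm : k ≤ m) (hn : k ≤ n) :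
    monomialIntegral k m n = monomialIntegral (k + 1) m n - monomialIntegral (k + 1) (m + 2) n
      - monomialIntegral (k + 1) m (n + 2) := by
  unfold monomialIntegral
  have i1 := integrableOn_monomialForm (k := k + 1) (m := m) (n := n) (by omega) (by omega)
  have i2 := integrableOn_monomialForm (k := k + 1) (m := m + 2) (n := n) (by omega) (by omega)
  have i3 := integrableOn_monomialForm (k := k + 1) (m := m) (n := n + 2) (by omega) (by omega)
  rw [← integral_sub' i1 i2, ← integral_sub (i1.sub i2) i3]
  refine integral_congr_ae ?_
  filter_upwards [ae_den_pos] with p hp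
  simp only [monomialForm, Pi.sub_apply]
  rw [← sub_div, ← sub_div, div_eq_div_iff (by positivity) (by positivity)]
  ring

/-- The integrand is the `y`-derivative of `x^(k+1+p) y^(k+q+1) / D^(k+1)`. The exponents are chosen
so that the primitive vanishes at `y = 0` and, as `D = 2x(1-x)` at `y = 1 - x`, has a polynomial
value there. -/
theorem integral_slice_deriv (k p q : ℕ) {x : ℝ} (hx : x ∈ Set.Ioo (0 : ℝ) 1) :
    ∫ y in Set.Ioc 0 (1 - x), (((k : ℝ) + 1 + q) * monomialForm (k + 1) (k + 1 + p) (k + q) (x, y)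
        + 2 * ((k : ℝ) + 1) * monomialForm (k + 2) (k + 1 + p) (k + q + 2) (x, y)) =
      x ^ p * (1 - x) ^ q / 2 ^ (k + 1) := by
  have h0 : 0 ≤ 1 - x := by linarith [hx.2]
  have hne : ∀ y ∈ Set.uIcc 0 (1 - x), 1 - x ^ 2 - y ^ 2 ≠ 0 := by
    intro y hy
    rw [Set.uIcc_of_le h0] at hy
    exact (den_pos hx.1 hy.1 hy.2 hx.2).ne'
  have hd : ∀ y ∈ Set.uIcc 0 (1 - x),
      HasDerivAt (fun y => x ^ (k + 1 + p) * y ^ (k + q + 1) / (1 - x ^ 2 - y ^ 2) ^ (k + 1))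
        (((k : ℝ) + 1 + q) * monomialForm (k + 1) (k + 1 + p) (k + q) (x, y)
        + 2 * ((k : ℝ) + 1) * monomialForm (k + 2) (k + 1 + p) (k + q + 2) (x, y)) y := by
    intro y hy
    have h := hne y hy
    refine (((hasDerivAt_pow (k + q + 1) y).const_mul (x ^ (k + 1 + p))).div
      (((hasDerivAt_pow 2 y).const_sub (1 - x ^ 2)).fun_pow (k + 1))
      (pow_ne_zero _ h)).congr_deriv ?_
    simp only [monomialForm, Nat.add_sub_cancel]
    push_cast
    field_simp
    ring
  rw [← intervalIntegral.integral_of_le h0, intervalIntegral.integral_eq_sub_of_hasDerivAt hd]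
  · have h1 : 1 - x ≠ 0 := by linarith [hx.2]
    have h2 : x ≠ 0 := hx.1.ne'
    rw [show 1 - x ^ 2 - (1 - x) ^ 2 = 2 * x * (1 - x) by ring]
    rw [zero_pow (by omega), mul_zero, zero_div, sub_zero, mul_pow, mul_pow,
      div_eq_div_iff (by positivity) (by positivity)]
    ring
  · refine ContinuousOn.intervalIntegrable ?_
    unfold monomialForm
    refine ContinuousOn.add (ContinuousOn.mul (by fun_prop) ?_) (ContinuousOn.mul (by fun_prop) ?_)
    all_goals
      exact ContinuousOn.div (by fun_prop) (by fun_prop) fun y hy => pow_ne_zero _ (hne y hy)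

theorem monomialIntegral_stokes_snd (k p q : ℕ) :
    ((k : ℝ) + 1 + q) * monomialIntegral (k + 1) (k + 1 + p) (k + q)
        + 2 * ((k : ℝ) + 1) * monomialIntegral (k + 2) (k + 1 + p) (k + q + 2) =
      (p.factorial * q.factorial : ℝ) / (2 ^ (k + 1) * (p + q + 1).factorial) := by
  have i1 := (integrableOn_monomialForm (k := k + 1) (m := k + 1 + p) (n := k + q) (by omega)
    (by omega)).const_mul ((k : ℝ) + 1 + q)
  have i2 := (integrableOn_monomialForm (k := k + 2) (m := k + 1 + p) (n := k + q + 2) (by omega)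
    (by omega)).const_mul (2 * ((k : ℝ) + 1))
  rw [monomialIntegral, monomialIntegral, ← integral_const_mul, ← integral_const_mul,
    ← integral_add i1 i2]
  refine (setIntegral_simplex (i1.add i2)).trans ?_
  refine (setIntegral_congr_fun measurableSet_Ioo
    fun x hx => integral_slice_deriv k p q hx).trans ?_
  rw [integral_div, integral_pow_mul_one_sub_pow, div_div, mul_comm (Nat.cast _) (2 ^ (k + 1) : ℝ)]

theorem monomialIntegral_stokes_fst (k p q : ℕ) :
    ((k : ℝ) + 1 + p) * monomialIntegral (k + 1) (k + p) (k + 1 + q)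
        + 2 * ((k : ℝ) + 1) * monomialIntegral (k + 2) (k + p + 2) (k + 1 + q) =
      (p.factorial * q.factorial : ℝ) / (2 ^ (k + 1) * (p + q + 1).factorial) := by
  rw [monomialIntegral_swap, monomialIntegral_swap (k + 2), monomialIntegral_stokes_snd,
    add_comm p q, mul_comm (p.factorial : ℝ)]

theorem monomialIntegral_zero_pole (m n : ℕ) :
    monomialIntegral 0 m n = (m.factorial * n.factorial : ℝ) / (m + n + 2).factorial := by
  rw [monomialIntegral, setIntegral_simplex (integrableOn_monomialForm (by omega) (by omega))]
  have h : ∀ x ∈ Set.Ioo (0 : ℝ) 1, ∫ y in Set.Ioc 0 (1 - x), monomialForm 0 m n (x, y) =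
      x ^ m * (1 - x) ^ (n + 1) / ((n : ℝ) + 1) := by
    intro x hx
    simp only [monomialForm, pow_zero, div_one]
    rw [integral_const_mul, ← intervalIntegral.integral_of_le (by linarith [hx.2]), integral_pow]
    simp [mul_div_assoc]
  rw [setIntegral_congr_fun measurableSet_Ioo h, integral_div, integral_pow_mul_one_sub_pow,
    ← add_assoc, Nat.factorial_succ n]
  push_cast
  field_simp

theorem monomialIntegral_one_zero_zero : monomialIntegral 1 0 0 = catalanConst := by
  rw [← integral_one_div_den]
  simp [monomialIntegral, monomialForm]

/-- Subtracting the two Stokes relations eliminates `I_2(p+2,q+2)`; lowering the pole to order zero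
then eliminates `I_1(p,q+2)`. -/
theorem monomialIntegral_simple_pole_succ (p q : ℕ) :
    ((p : ℝ) + q + 2) * monomialIntegral 1 (p + 2) q =
      (p + 1) * monomialIntegral 1 p q
        - (p.factorial * q.factorial : ℝ) / (2 * (p + q + 1).factorial) := by
  have h1 := monomialIntegral_stokes_snd 0 (p + 1) q
  have h2 := monomialIntegral_stokes_fst 0 p (q + 1)
  have h3 := monomialIntegral_lower_pole (Nat.zero_le p) (Nat.zero_le q)
  rw [monomialIntegral_zero_pole] at h3
  rw [show 0 + 1 + (p + 1) = p + 2 by ring, show p + 1 + q + 1 = p + q + 2 by ring] at h1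
  rw [show 0 + 1 + (q + 1) = q + 2 by ring, show p + (q + 1) + 1 = p + q + 2 by ring] at h2
  simp only [zero_add, Nat.factorial_succ p, Nat.factorial_succ q,
    Nat.factorial_succ (p + q + 1)] at h1 h2 h3
  push_cast at h1 h2 h3
  have e : (p.factorial * q.factorial : ℝ) / (2 * (p + q + 1).factorial) =
      (p + q + 2) * ((p.factorial * q.factorial : ℝ) /
        (2 * ((p + q + 1 + 1) * (p + q + 1).factorial))) := by
    field_simp
    ring
  have e3 : (p.factorial * q.factorial : ℝ) / ((p + q + 1 + 1) * (p + q + 1).factorial) =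
      2 * ((p.factorial * q.factorial : ℝ) /
        (2 * ((p + q + 1 + 1) * (p + q + 1).factorial))) := by
    field_simp
  have e1 : (((p : ℝ) + 1) * p.factorial * q.factorial : ℝ) /
      (2 ^ 1 * ((p + q + 1 + 1) * (p + q + 1).factorial)) =
      (p + 1) * ((p.factorial * q.factorial : ℝ) /
        (2 * ((p + q + 1 + 1) * (p + q + 1).factorial))) := by
    rw [pow_one]
    ring
  have e2 : (p.factorial * (((q : ℝ) + 1) * q.factorial) : ℝ) /
      (2 ^ 1 * ((p + q + 1 + 1) * (p + q + 1).factorial)) =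
      (q + 1) * ((p.factorial * q.factorial : ℝ) /
        (2 * ((p + q + 1 + 1) * (p + q + 1).factorial))) := by
    rw [pow_one]
    ring
  rw [e1] at h1
  rw [e2] at h2
  rw [e3] at h3
  rw [e]
  generalize (p.factorial * q.factorial : ℝ) /
        (2 * ((p + q + 1 + 1) * (p + q + 1).factorial)) = B at *
  linear_combination h1 - h2 + (p + 1) * h3

/-- Both Stokes relations contain `I_{N+2}(N+p+2,N+q+2)`, so they are added. -/
theorem monomialIntegral_pole_succ (N p q : ℕ) :
    4 * ((N : ℝ) + 1) * monomialIntegral (N + 2) (N + p + 2) (N + q + 2) =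
      (p.factorial * q.factorial : ℝ) / (2 ^ (N + 1) * (p + q + 1).factorial)
        - (N + p + 1) * monomialIntegral (N + 1) (N + p) (N + q + 2)
        - (N + q + 1) * monomialIntegral (N + 1) (N + p + 2) (N + q) := by
  have h1 := monomialIntegral_stokes_snd N (p + 1) q
  have h2 := monomialIntegral_stokes_fst N p (q + 1)
  rw [show N + 1 + (p + 1) = N + p + 2 by ring, show p + 1 + q + 1 = p + q + 2 by ring] at h1
  rw [show N + 1 + (q + 1) = N + q + 2 by ring, show p + (q + 1) + 1 = p + q + 2 by ring] at h2
  have e : (p.factorial * q.factorial : ℝ) / (2 ^ (N + 1) * (p + q + 1).factorial) =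
      ((p + 1).factorial * q.factorial : ℝ) / (2 ^ (N + 1) * (p + q + 2).factorial) +
      (p.factorial * (q + 1).factorial : ℝ) / (2 ^ (N + 1) * (p + q + 2).factorial) := by
    rw [Nat.factorial_succ p, Nat.factorial_succ q, Nat.factorial_succ (p + q + 1)]
    push_cast
    field_simp
    ring
  rw [e]
  linear_combination h1 + h2

/-- One Stokes step in each variable, linked by `I_{N+2}(N+p+2,N+q+1)`. Convergence of this
intermediate integral is why the second exponent carries `q + 1`. -/
theorem monomialIntegral_pole_add_two_of_succ (N p q : ℕ) :
    4 * ((N : ℝ) + 1) * (N + 2) * monomialIntegral (N + 3) (N + p + 2) (N + (q + 1) + 2) =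
      (N + p + 1) * (N + (q + 1) + 1) * monomialIntegral (N + 1) (N + p) (N + (q + 1))
        - (p.factorial * (q + 1).factorial : ℝ) / (2 ^ (N + 1) * (p + (q + 1)).factorial) := by
  have h1 := monomialIntegral_stokes_snd (N + 1) p q
  have h2 := monomialIntegral_stokes_fst N p q
  rw [show N + 1 + 1 + p = N + p + 2 by ring, show N + 1 + q = N + (q + 1) by ring] at h1
  rw [show N + 1 + q = N + (q + 1) by ring] at h2
  have e1 : (p.factorial * q.factorial : ℝ) / (2 ^ (N + 1 + 1) * (p + q + 1).factorial) =
      (p.factorial * q.factorial : ℝ) / (2 ^ (N + 1) * (p + q + 1).factorial) / 2 := by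
    rw [pow_succ (2 : ℝ) (N + 1)]
    ring
  have e2 : (p.factorial * (q + 1).factorial : ℝ) / (2 ^ (N + 1) * (p + (q + 1)).factorial) =
      (q + 1) * ((p.factorial * q.factorial : ℝ) / (2 ^ (N + 1) * (p + q + 1).factorial)) := by
    rw [Nat.factorial_succ q, ← add_assoc]
    push_cast
    ring
  rw [e1] at h1
  rw [e2]
  push_cast at h1
  linear_combination (2 * (N + 1)) * h1 - (N + q + 2) * h2

/-- This supplies the corner case `p = q = 0` of `monomialIntegral_pole_add_two`, where the
intermediate integral of the two-step argument is outside the convergence range. For `N > 0`, the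
sum of both Stokes relations is combined with a lowering of the pole. -/
theorem monomialIntegral_euler (N : ℕ) :
    monomialIntegral (N + 1) (N + 2) N + monomialIntegral (N + 1) N (N + 2) =
      (N + 1) * monomialIntegral (N + 1) N N - 1 / 2 ^ (N + 1) := by
  have h3 := monomialIntegral_lower_pole (le_refl N) (le_refl N)
  cases N with
  | zero =>
    rw [monomialIntegral_zero_pole] at h3
    norm_num at h3 ⊢
    linarith
  | succ N =>
    have h1 := monomialIntegral_stokes_snd N 0 1
    have h2 := monomialIntegral_stokes_fst N 1 0
    rw [show N + 1 + 0 = N + 1 by ring, show N + 1 + 2 = N + 3 by ring] at h1 h2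
    norm_num at h1 h2
    rw [show N + 1 + 1 = N + 2 by ring, show N + 1 + 2 = N + 3 by ring] at *
    have e : (1 : ℝ) / 2 ^ (N + 2) = ((2 ^ (N + 1))⁻¹ * 2⁻¹) := by
      rw [pow_succ (2 : ℝ) (N + 1)]
      field_simp
    rw [e]
    push_cast
    linear_combination -(h1 + h2) / 2 + (N + 2) * h3

theorem monomialIntegral_pole_add_two (N p q : ℕ) :
    4 * ((N : ℝ) + 1) * (N + 2) * monomialIntegral (N + 3) (N + p + 2) (N + q + 2) =
      (N + p + 1) * (N + q + 1) * monomialIntegral (N + 1) (N + p) (N + q)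
        - (p.factorial * q.factorial : ℝ) / (2 ^ (N + 1) * (p + q).factorial) := by
  rcases q with _ | q
  · rcases p with _ | p
    -- Lowering the pole and symmetry express `I_{N+3}(N+2,N+2)` by `I_{N+2}(N+2,N+2)` and
    -- `I_{N+3}(N+2,N+4)`, both already reduced to pole order `N+1`; the Euler relation closes the
    -- system.
    · have h1 := monomialIntegral_pole_add_two_of_succ N 0 1
      have h2 := monomialIntegral_lower_pole (le_refl (N + 2)) (le_refl (N + 2))
      have h3 := monomialIntegral_pole_succ N 0 0
      have h4 := monomialIntegral_euler N
      have h5 : monomialIntegral (N + 3) (N + 2 + 2) (N + 2) =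
        monomialIntegral (N + 3) (N + 2) (N + 2 + 2) := monomialIntegral_swap _ _ _
      have h6 : monomialIntegral (N + 1) (N + 2) N = monomialIntegral (N + 1) N (N + 2) :=
        monomialIntegral_swap _ _ _
      simp only [add_zero, zero_add, Nat.reduceAdd, Nat.factorial_zero, Nat.cast_one, Nat.cast_zero,
        Nat.factorial_one, Nat.factorial_two, mul_one, one_mul, Nat.cast_ofNat] at *
      rw [show N + 2 + 1 = N + 3 by ring] at h2
      have e : (2 : ℝ) / (2 ^ (N + 1) * 2) = 1 / 2 ^ (N + 1) := by field_simp
      rw [e] at h1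
      rw [h5] at h2
      rw [h6] at h3 h4
      linear_combination 2 * h1 - 4 * ((N : ℝ) + 1) * (N + 2) * h2 + (N + 2) * h3 + (N + 1) * h4
    · have h := monomialIntegral_pole_add_two_of_succ N 0 p
      rw [monomialIntegral_swap, monomialIntegral_swap (N + 1)] at h
      simp only [add_zero, zero_add, Nat.cast_zero] at h ⊢
      push_cast
      linear_combination h
  · have h := monomialIntegral_pole_add_two_of_succ N p q
    push_cast
    exact h

/-! ### Recurrences for the coefficient of the Catalan constant. -/

/-- The part of `monomialCatalan t u v` that does not depend on the pole order, up to sign and the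
factor `(u + v).choose t`. -/
def centralRatio (u v : ℕ) : ℚ :=
  ((2 * u).choose u * (2 * v).choose v) / (4 ^ (u + v) * (u + v).choose u)

theorem monomialCatalan_eq (t u v : ℕ) :
    monomialCatalan t u v = (-1) ^ t * (u + v).choose t * centralRatio u v := by
  rw [monomialCatalan, centralRatio]
  ring

theorem centralRatio_succ_left (u v : ℕ) :
    centralRatio (u + 1) v = (2 * u + 1) / (2 * (u + v + 1)) * centralRatio u v := by
  have h1 : ((u : ℚ) + 1) * ((2 * (u + 1)).choose (u + 1)) = 2 * (2 * u + 1) * (2 * u).choose u := by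
    have := Nat.succ_mul_centralBinom_succ u
    simp only [Nat.centralBinom] at this
    exact_mod_cast this
  have h2 : ((u : ℚ) + v + 1) * (u + v).choose u = (u + 1 + v).choose (u + 1) * (u + 1) := by
    have := Nat.add_one_mul_choose_eq (u + v) u
    rw [show u + v + 1 = u + 1 + v by ring] at this
    have h : ((u + 1 + v : ℕ) : ℚ) * (u + v).choose u = (u + 1 + v).choose (u + 1) * (u + 1) := by
      exact_mod_cast this
    push_cast at h
    linear_combination h
  have hpos1 : ((u + v).choose u : ℚ) ≠ 0 :=
    Nat.cast_ne_zero.2 (Nat.choose_pos (by omega)).ne'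
  have hpos2 : ((u + 1 + v).choose (u + 1) : ℚ) ≠ 0 :=
    Nat.cast_ne_zero.2 (Nat.choose_pos (by omega)).ne'
  have hu : (u : ℚ) + 1 ≠ 0 := by positivity
  have huv : (u : ℚ) + v + 1 ≠ 0 := by positivity
  have e1 : ((2 * (u + 1)).choose (u + 1) : ℚ) = 2 * (2 * u + 1) * (2 * u).choose u / (u + 1) := by
    rw [← h1]
    field_simp
  have e2 : ((u + 1 + v).choose (u + 1) : ℚ) = (u + v + 1) * (u + v).choose u / (u + 1) := by
    rw [h2]
    field_simp
  rw [centralRatio, centralRatio, e1, e2, show u + 1 + v = u + v + 1 by ring, pow_succ]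
  field_simp
  ring

theorem centralRatio_comm (u v : ℕ) : centralRatio u v = centralRatio v u := by
  rw [centralRatio, centralRatio, Nat.add_comm u v, ← Nat.choose_symm_add, mul_comm (Nat.cast _)]

theorem centralRatio_succ_right (u v : ℕ) :
    centralRatio u (v + 1) = (2 * v + 1) / (2 * (u + v + 1)) * centralRatio u v := by
  rw [centralRatio_comm, centralRatio_succ_left, centralRatio_comm v, add_comm (v : ℚ)]

theorem choose_succ_succ_cast (n t : ℕ) :
    ((n + 1).choose (t + 1) : ℚ) = (n + 1) / (t + 1) * n.choose t := by
  have h : ((n : ℚ) + 1) * n.choose t = (n + 1).choose (t + 1) * (t + 1) := by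
    exact_mod_cast Nat.add_one_mul_choose_eq n t
  have ht : (t : ℚ) + 1 ≠ 0 := by positivity
  field_simp
  linear_combination -h

theorem monomialCatalan_comm (t u v : ℕ) : monomialCatalan t u v = monomialCatalan t v u := by
  rw [monomialCatalan_eq, monomialCatalan_eq, centralRatio_comm, add_comm u]

theorem monomialCatalan_zero_succ_left (i j : ℕ) :
    monomialCatalan 0 (i + 1) j = (2 * i + 1) / (2 * i + 2 * j + 2) * monomialCatalan 0 i j := by
  rw [monomialCatalan_eq, monomialCatalan_eq, centralRatio_succ_left, Nat.choose_zero_right,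
    Nat.choose_zero_right, show (2 * (i + j + 1) : ℚ) = 2 * i + 2 * j + 2 by ring]
  ring

theorem monomialCatalan_pole_add_two (t u v : ℕ) :
    monomialCatalan (t + 2) (u + 1) (v + 1) =
      (2 * u + 1) * (2 * v + 1) * monomialCatalan t u v / (4 * (t + 1) * (t + 2)) := by
  rw [monomialCatalan_eq, monomialCatalan_eq, centralRatio_succ_left, centralRatio_succ_right,
    show u + 1 + (v + 1) = u + v + 1 + 1 by ring, choose_succ_succ_cast, choose_succ_succ_cast]
  have : (u : ℚ) + v + 1 ≠ 0 := by positivity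
  have : (u : ℚ) + v + 2 ≠ 0 := by positivity
  push_cast
  rw [show (u : ℚ) + (v + 1) + 1 = u + v + 2 by ring, show (u : ℚ) + v + 1 + 1 = u + v + 2 by ring,
    show (t : ℚ) + 1 + 1 = t + 2 by ring]
  field_simp
  ring

theorem monomialCatalan_pole_succ (t u v : ℕ) :
    monomialCatalan (t + 1) (u + 1) (v + 1) =
      -((2 * u + 1) * monomialCatalan t u (v + 1) + (2 * v + 1) * monomialCatalan t (u + 1) v)
        / (4 * (t + 1)) := by
  rw [monomialCatalan_eq, monomialCatalan_eq, monomialCatalan_eq, centralRatio_succ_left,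
    centralRatio_succ_right, centralRatio_succ_left,
    show u + 1 + (v + 1) = u + v + 1 + 1 by ring, choose_succ_succ_cast,
    show u + 1 + v = u + v + 1 by ring, ← add_assoc u v 1]
  have : (u : ℚ) + v + 1 ≠ 0 := by positivity
  have : (u : ℚ) + v + 2 ≠ 0 := by positivity
  push_cast
  rw [show (u : ℚ) + (v + 1) + 1 = u + v + 2 by ring, show (u : ℚ) + v + 1 + 1 = u + v + 2 by ring]
  field_simp
  ring

/-! ### Linear forms for the even monomials. -/

theorem simplePoleOne_zero_succ (j : ℕ) :
    simplePoleOne 0 (j + 1) = (2 * j + 1) / (2 * j + 2) * simplePoleOne 0 j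
        - (2 * j).factorial / (2 * (2 * j + 2).factorial) := by
  rw [simplePoleOne]

theorem simplePoleOne_succ (i j : ℕ) :
    simplePoleOne (i + 1) j = (2 * i + 1) / (2 * i + 2 * j + 2) * simplePoleOne i j
        - (2 * i).factorial * (2 * j).factorial / (2 * (2 * i + 2 * j + 2).factorial) := by
  rw [simplePoleOne]

theorem monomialIntegral_simple_pole_add_one (i j : ℕ) :
    monomialIntegral 1 (2 * (i + 1)) (2 * j) =
      (2 * i + 1) / (2 * i + 2 * j + 2) * monomialIntegral 1 (2 * i) (2 * j)
        - ((2 * i).factorial * (2 * j).factorial : ℝ) / (2 * (2 * i + 2 * j + 2).factorial) := by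
  have h := monomialIntegral_simple_pole_succ (2 * i) (2 * j)
  rw [Nat.factorial_succ (2 * i + 2 * j + 1), show 2 * (i + 1) = 2 * i + 2 by ring]
  push_cast at h ⊢
  have h1 : (2 : ℝ) * i + 2 * j + 2 ≠ 0 := by positivity
  apply mul_left_cancel₀ h1
  rw [h, show (2 : ℝ) * i + 2 * j + 1 + 1 = 2 * i + 2 * j + 2 by ring]
  field_simp

theorem monomialIntegral_simple_pole (i j : ℕ) :
    monomialIntegral 1 (2 * i) (2 * j) =
      (simplePoleOne i j : ℝ) + (monomialCatalan 0 i j : ℝ) * catalanConst := by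
  induction i with
  | zero =>
    induction j with
    | zero => simp [monomialIntegral_one_zero_zero, simplePoleOne, monomialCatalan]
    | succ j ih =>
      -- The recurrence lowers only the first exponent, so the variables are exchanged.
      rw [monomialIntegral_swap] at ih ⊢
      rw [monomialIntegral_simple_pole_add_one, ih, simplePoleOne_zero_succ,
        monomialCatalan_comm 0 0 (j + 1), monomialCatalan_comm 0 0 j,
        monomialCatalan_zero_succ_left]
      push_cast
      simp only [mul_zero, add_zero, Nat.factorial_zero, Nat.cast_one]
      ring
  | succ i ih =>
    rw [monomialIntegral_simple_pole_add_one, ih, simplePoleOne_succ,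
      monomialCatalan_zero_succ_left]
    push_cast
    ring

theorem monomialIntegral_odd_pole (s i j : ℕ) :
    monomialIntegral (2 * s + 1) (2 * (s + i)) (2 * (s + j)) =
      (evenPoleOne s i j : ℝ) + (monomialCatalan (2 * s) (s + i) (s + j) : ℝ) * catalanConst := by
  induction s with
  | zero => simpa [evenPoleOne] using monomialIntegral_simple_pole i j
  | succ s ih =>
    have h := monomialIntegral_pole_add_two (2 * s) (2 * i) (2 * j)
    rw [show 2 * s + 2 * i = 2 * (s + i) by ring, show 2 * s + 2 * j = 2 * (s + j) by ring, ih] at h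
    have hc : ((2 * i + 2 * j).choose (2 * i) : ℝ) * ((2 * i).factorial * (2 * j).factorial) =
        (2 * i + 2 * j).factorial := by
      rw [← Nat.add_choose_mul_factorial_mul_factorial (2 * i) (2 * j), Nat.choose_symm_add]
      push_cast
      ring
    have hpos : ((2 * i + 2 * j).choose (2 * i) : ℝ) ≠ 0 :=
      Nat.cast_ne_zero.2 (Nat.choose_pos (by omega)).ne'
    have e : ((2 * i).factorial * (2 * j).factorial : ℝ) /
        (2 ^ (2 * s + 1) * (2 * i + 2 * j).factorial) =
        1 / (2 ^ (2 * s + 1) * (2 * i + 2 * j).choose (2 * i)) := by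
      rw [← hc]
      field_simp
    rw [e] at h
    rw [show s + 1 + i = s + i + 1 by ring, show s + 1 + j = s + j + 1 by ring,
      show 2 * (s + 1) = 2 * s + 2 by ring, monomialCatalan_pole_add_two, evenPoleOne]
    rw [show 2 * (s + i + 1) = 2 * (s + i) + 2 by ring,
      show 2 * (s + j + 1) = 2 * (s + j) + 2 by ring]
    have hs : (4 : ℝ) * (2 * s + 1) * (2 * s + 2) ≠ 0 := by positivity
    apply mul_left_cancel₀ hs
    push_cast at h ⊢
    rw [h]
    field_simp
    ring

theorem monomialIntegral_even_pole (s i j : ℕ) :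
    monomialIntegral (2 * s + 2) (2 * (s + 1 + i)) (2 * (s + 1 + j)) =
      (oddPoleOne s i j : ℝ)
        + (monomialCatalan (2 * s + 1) (s + 1 + i) (s + 1 + j) : ℝ) * catalanConst := by
  have h := monomialIntegral_pole_succ (2 * s) (2 * i) (2 * j)
  rw [show 2 * s + 2 * i + 2 = 2 * (s + (i + 1)) by ring,
    show 2 * s + 2 * j + 2 = 2 * (s + (j + 1)) by ring,
    show 2 * s + 2 * i = 2 * (s + i) by ring, show 2 * s + 2 * j = 2 * (s + j) by ring,
    monomialIntegral_odd_pole, monomialIntegral_odd_pole] at h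
  rw [show s + 1 + i = s + i + 1 by ring, show s + 1 + j = s + j + 1 by ring,
    monomialCatalan_pole_succ, oddPoleOne]
  rw [← add_assoc, ← add_assoc] at h
  have hs : (4 : ℝ) * (2 * s + 1) ≠ 0 := by positivity
  apply mul_left_cancel₀ hs
  push_cast at h ⊢
  rw [h]
  field_simp
  ring

theorem natCeil_half_even (s : ℕ) : ⌈((2 * s : ℕ) : ℚ) / 2⌉₊ = s := by
  push_cast
  rw [mul_div_cancel_left₀ _ two_ne_zero, Nat.ceil_natCast]

theorem natCeil_half_odd (s : ℕ) : ⌈((2 * s + 1 : ℕ) : ℚ) / 2⌉₊ = s + 1 := by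
  rw [Nat.ceil_eq_iff (by omega)]
  push_cast
  constructor <;> linarith

theorem monomialIntegral_eq (t u v : ℕ) (hu : ⌈(t : ℚ) / 2⌉₊ ≤ u) (hv : ⌈(t : ℚ) / 2⌉₊ ≤ v) :
    monomialIntegral (t + 1) (2 * u) (2 * v) =
      (monomialOne t u v : ℝ) + (monomialCatalan t u v : ℝ) * catalanConst := by
  obtain ⟨s, rfl | rfl⟩ := Nat.even_or_odd' t
  · rw [natCeil_half_even] at hu hv
    obtain ⟨i, rfl⟩ := Nat.exists_eq_add_of_le hu
    obtain ⟨j, rfl⟩ := Nat.exists_eq_add_of_le hv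
    rw [monomialIntegral_odd_pole, monomialOne, if_pos (even_two_mul s),
      Nat.mul_div_cancel_left s two_pos, Nat.add_sub_cancel_left, Nat.add_sub_cancel_left]
  · rw [natCeil_half_odd] at hu hv
    obtain ⟨i, rfl⟩ := Nat.exists_eq_add_of_le hu
    obtain ⟨j, rfl⟩ := Nat.exists_eq_add_of_le hv
    rw [show 2 * s + 1 + 1 = 2 * s + 2 by ring, monomialIntegral_even_pole, monomialOne,
      if_neg (Nat.not_even_two_mul_add_one s), show (2 * s + 1) / 2 = s by omega,
      Nat.add_sub_cancel_left, Nat.add_sub_cancel_left]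

/-! ### The symmetry `σ` and cancellation of the other monomials. -/

/-- The exponent with the two coordinates exchanged. -/
noncomputable def swapExponent (d : Fin 2 →₀ ℕ) : Fin 2 →₀ ℕ :=
  Finsupp.equivMapDomain (Equiv.swap 0 1) d

@[simp] theorem swapExponent_zero (d : Fin 2 →₀ ℕ) : swapExponent d 0 = d 1 := by
  simp [swapExponent, Finsupp.equivMapDomain_apply]

@[simp] theorem swapExponent_one (d : Fin 2 →₀ ℕ) : swapExponent d 1 = d 0 := by
  simp [swapExponent, Finsupp.equivMapDomain_apply]

@[simp] theorem swapExponent_swapExponent (d : Fin 2 →₀ ℕ) :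
    swapExponent (swapExponent d) = d := by
  ext i
  fin_cases i <;> simp

theorem sigma_monomial (d : Fin 2 →₀ ℕ) (a : ℚ) :
    sigma (monomial d a) = monomial (swapExponent d) ((-1) ^ d 0 * a) := by
  rw [sigma, aeval_monomial, monomial_eq (s := swapExponent d),
    Finsupp.prod_fintype _ _ (by simp), Finsupp.prod_fintype _ _ (by simp)]
  simp only [Fin.prod_univ_two, swapExponent_zero, swapExponent_one, Matrix.cons_val_zero,
    Matrix.cons_val_one, algebraMap_eq, neg_pow (X 1 : MvPolynomial (Fin 2) ℚ), C_mul, C_pow,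
    C_neg, C_1]
  ring

theorem coeff_swapExponent_sigma (F : MvPolynomial (Fin 2) ℚ) (d : Fin 2 →₀ ℕ) :
    (sigma F).coeff (swapExponent d) = (-1) ^ d 0 * F.coeff d := by
  induction F using MvPolynomial.induction_on' with
  | monomial e a =>
    rw [sigma_monomial, coeff_monomial, coeff_monomial]
    by_cases h : e = d
    · simp [h]
    · rw [if_neg h, if_neg, mul_zero]
      intro h'
      exact h (by rw [← swapExponent_swapExponent e, h', swapExponent_swapExponent])
  | add p q hp hq => rw [map_add, coeff_add, coeff_add, hp, hq, mul_add]

theorem exponent_ge_of_dvd {c : ℕ} {F : MvPolynomial (Fin 2) ℚ}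
    (h : (X 0 : MvPolynomial (Fin 2) ℚ) ^ c * X 1 ^ c ∣ F) {d : Fin 2 →₀ ℕ}
    (hd : d ∈ F.support) : c ≤ d 0 ∧ c ≤ d 1 := by
  obtain ⟨H, rfl⟩ := h
  rw [mem_support_iff, X_pow_eq_monomial, X_pow_eq_monomial, monomial_mul,
    coeff_monomial_mul'] at hd
  have hle : Finsupp.single 0 c + Finsupp.single 1 c ≤ d := by
    by_contra hn
    exact hd (if_neg hn)
  exact ⟨by simpa using hle 0, by simpa using hle 1⟩

theorem integrand_eq_sum (t : ℕ) (F : MvPolynomial (Fin 2) ℚ) :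
    integrand t F = fun p => ∑ d ∈ F.support,
      ((F.coeff d : ℚ) : ℝ) * monomialForm (t + 1) (d 0) (d 1) p := by
  funext p
  rw [integrand, aeval_def, eval₂_eq', Finset.sum_div]
  refine Finset.sum_congr rfl fun d _ => ?_
  rw [monomialForm, Fin.prod_univ_two, mul_div_assoc]
  rfl

/-- Invariance gives `c_{n,m} = (-1)^m c_{m,n}`. Applied twice it forces `m + n` to be even on the
support; for `m, n` both odd, exchanging the exponents changes the sign of the term, so the sum
equals its own negative. -/
theorem sum_not_even_eq_zero {F : MvPolynomial (Fin 2) ℚ} (hσ : sigma F = F) (k : ℕ) :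
    ∑ d ∈ F.support with ¬(Even (d 0) ∧ Even (d 1)),
      ((F.coeff d : ℚ) : ℝ) * monomialIntegral k (d 0) (d 1) = 0 := by
  have hc (d : Fin 2 →₀ ℕ) : F.coeff (swapExponent d) = (-1) ^ d 0 * F.coeff d := by
    rw [← coeff_swapExponent_sigma, hσ]
  have hc2 (d : Fin 2 →₀ ℕ) : F.coeff d = (-1) ^ d 1 * ((-1) ^ d 0 * F.coeff d) := by
    rw [← hc, ← swapExponent_zero d, ← hc, swapExponent_swapExponent]
  have hodd {d : Fin 2 →₀ ℕ} (hd : F.coeff d ≠ 0) (hn : ¬(Even (d 0) ∧ Even (d 1))) :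
      Odd (d 0) ∧ Odd (d 1) := by
    rcases Nat.even_or_odd (d 0) with h0 | h0 <;> rcases Nat.even_or_odd (d 1) with h1 | h1
    · exact absurd ⟨h0, h1⟩ hn
    · have := hc2 d
      rw [h0.neg_one_pow, h1.neg_one_pow] at this
      exact absurd (by linarith) hd
    · have := hc2 d
      rw [h0.neg_one_pow, h1.neg_one_pow] at this
      exact absurd (by linarith) hd
    · exact ⟨h0, h1⟩
  have h : ∑ d ∈ F.support with ¬(Even (d 0) ∧ Even (d 1)),
      ((F.coeff d : ℚ) : ℝ) * monomialIntegral k (d 0) (d 1) =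
      ∑ d ∈ F.support with ¬(Even (d 0) ∧ Even (d 1)),
        -(((F.coeff d : ℚ) : ℝ) * monomialIntegral k (d 0) (d 1)) := by
    refine Finset.sum_nbij' swapExponent swapExponent ?_ ?_
      (fun d _ => swapExponent_swapExponent d) (fun d _ => swapExponent_swapExponent d) ?_
    · intro d
      simp only [Finset.mem_filter, mem_support_iff, hc, swapExponent_zero, swapExponent_one]
      rintro ⟨h1, h2⟩
      exact ⟨mul_ne_zero (by simp) h1, fun h => h2 h.symm⟩
    · intro d
      simp only [Finset.mem_filter, mem_support_iff, hc, swapExponent_zero, swapExponent_one]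
      rintro ⟨h1, h2⟩
      exact ⟨mul_ne_zero (by simp) h1, fun h => h2 h.symm⟩
    · intro d
      simp only [Finset.mem_filter, mem_support_iff]
      rintro ⟨h1, h2⟩
      rw [hc, (hodd h1 h2).1.neg_one_pow, swapExponent_zero, swapExponent_one,
        monomialIntegral_swap k (d 1)]
      push_cast
      ring
  rw [Finset.sum_neg_distrib] at h
  linarith

end CatalanForms

/-! ### Assembly over the monomials of `F`. -/

theorem theorem1p1 (t : ℕ) (F : MvPolynomial (Fin 2) ℚ)
    (hσ : CatalanForms.sigma F = F)
    (hdvd : (MvPolynomial.X 0 : MvPolynomial (Fin 2) ℚ) ^ (2 * ⌈(t : ℚ) / 2⌉₊)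
      * MvPolynomial.X 1 ^ (2 * ⌈(t : ℚ) / 2⌉₊) ∣ F) :
    MeasureTheory.IntegrableOn (CatalanForms.integrand t F) CatalanForms.simplex
        MeasureTheory.volume ∧
      (∃ a b : ℚ,
        (∫ p in CatalanForms.simplex, CatalanForms.integrand t F p) =
          (a : ℝ) + (b : ℝ) * CatalanForms.catalanConst) ∧
      (∫ p in CatalanForms.simplex, CatalanForms.integrand t F p) =
        (CatalanForms.coeffOne t F : ℝ)
          + (CatalanForms.coeffCatalan t F : ℝ) * CatalanForms.catalanConst := by
  open CatalanForms MeasureTheory in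
  have hge {d : Fin 2 →₀ ℕ} (hd : d ∈ F.support) := exponent_ge_of_dvd hdvd hd
  -- Exponents at least `t` are exactly what the convergence criterion asks for a pole of order `t +
  -- 1`.
  have ht : t ≤ 2 * ⌈(t : ℚ) / 2⌉₊ := by
    have := Nat.le_ceil ((t : ℚ) / 2)
    rw [div_le_iff₀ two_pos] at this
    rw [mul_comm]
    exact_mod_cast this
  have hint : ∀ d ∈ F.support, IntegrableOn
      (fun p => ((F.coeff d : ℚ) : ℝ) * monomialForm (t + 1) (d 0) (d 1) p) simplex := fun d hd =>
    (integrableOn_monomialForm (by have := (hge hd).1; omega)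
      (by have := (hge hd).2; omega)).const_mul _
  have main : ∫ p in simplex, integrand t F p =
      (coeffOne t F : ℝ) + (coeffCatalan t F : ℝ) * catalanConst := by
    rw [integrand_eq_sum, integral_finsetSum _ hint]
    simp_rw [integral_const_mul]
    change ∑ d ∈ F.support, ((F.coeff d : ℚ) : ℝ) * monomialIntegral (t + 1) (d 0) (d 1) = _
    rw [← Finset.sum_filter_add_sum_filter_not F.support (fun d => Even (d 0) ∧ Even (d 1)),
      sum_not_even_eq_zero hσ, add_zero, coeffOne, coeffCatalan]
    push_cast
    rw [Finset.sum_mul, ← Finset.sum_add_distrib]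
    refine Finset.sum_congr rfl fun d hd => ?_
    obtain ⟨hd, h0, h1⟩ := Finset.mem_filter.1 hd
    have := hge hd
    have e := monomialIntegral_eq t (d 0 / 2) (d 1 / 2) (by omega) (by omega)
    rw [Nat.two_mul_div_two_of_even h0, Nat.two_mul_div_two_of_even h1] at e
    rw [e]
    ring
  refine ⟨?_, ⟨_, _, main⟩, main⟩
  rw [integrand_eq_sum]
  exact integrable_finsetSum _ hint
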